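/- All graphs are simple and undirected. For integers $q\ge 2$ and $d\ge 1$, let $K_q^d$ be the Hamming graph with vertex set $\{1,\dots,q\}^d$, in which two vertices are adjacent if and only if they differ in exactly one coordinate. For a graph $G$ and an integer $k\ge 0$, let $G^{(k)}$ be the graph formed by replacing each vertex of $G$ with a $k$-clique: its vertices are $u_i$ for $u\in V(G)$ and $1\le i\le k$, and distinct vertices $u_i\ne v_j$ are adjacent if and only if $u=v$ or $uv\in E(G)$. A graph $H$ is a minor of a graph $G$ if one can assign to the vertices $u$ of $H$ pairwise disjoint nonempty connected vertex sets $\phi(u)\subseteq V(G)$ such that whenever $uv\in E(H)$ there is an edge of $G$ with one endpoint in $\phi(u)$ and the other in $\phi(v)$. Let $\mathrm{emb}(G)$ be the supremum of all real $r>0$ for which there exists $m_0=m_0(G,r)$ such that every finite graph $H$ without isolated vertices and with $m\ge m_0$ edges is a minor of $G^{(\lceil m/r\rceil)}$. Then $\mathrm{emb}(K_q^d)=\Theta(q^d/d)$: there are absolute constants $c,C>0$ such that for all integers $q\ge 2$ and $d\ge 1$, $$c\,\frac{q^d}{d}\;\le\;\mathrm{emb}(K_q^d)\;\le\;C\,\frac{q^d}{d}.$$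 -/

import Mathlib

open scoped ENNReal

/-- The Hamming graph `K_q^d`, the Cartesian product of `d` copies of the complete graph on `q`
vertices: the vertices are the words of length `d` over an alphabet of size `q`, and two words are
adjacent if and only if they differ in exactly one coordinate. -/
def hammingGraph (q d : ℕ) : SimpleGraph (Fin d → Fin q) where
  Adj x y := hammingDist x y = 1
  symm := ⟨fun x y h => by rw [hammingDist_comm]; exact h⟩
  loopless := ⟨fun x h => by simp at h⟩

/-- The blow-up `G^(k)`: every vertex of `G` is replaced by a `k`-clique, and two distinct vertices
`(u, i)` and `(v, j)` are adjacent if and only if `u = v` or `uv` is an edge of `G`. -/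
def blowup {V : Type*} (G : SimpleGraph V) (k : ℕ) : SimpleGraph (V × Fin k) where
  Adj x y := x ≠ y ∧ (x.1 = y.1 ∨ G.Adj x.1 y.1)
  symm := ⟨fun _ _ h => ⟨h.1.symm, h.2.imp Eq.symm SimpleGraph.Adj.symm⟩⟩
  loopless := ⟨fun _ h => h.1 rfl⟩

/-- `φ` is a minor mapping from `H` to `G`: it assigns to the vertices of `H` pairwise disjoint
(nonempty) connected vertex sets of `G`, such that the sets of adjacent vertices of `H` are joined
by an edge of `G`. (`SimpleGraph.Connected` includes nonemptiness.) -/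
structure IsMinorMapping {W V : Type*} (H : SimpleGraph W) (G : SimpleGraph V)
    (φ : W → Set V) : Prop where
  connected : ∀ u, (G.induce (φ u)).Connected
  disjoint : ∀ u v, u ≠ v → Disjoint (φ u) (φ v)
  adj : ∀ u v, H.Adj u v → ∃ x ∈ φ u, ∃ y ∈ φ v, G.Adj x y

/-- `H` is a minor of `G`. -/
def IsMinor {W V : Type*} (H : SimpleGraph W) (G : SimpleGraph V) : Prop :=
  ∃ φ : W → Set V, IsMinorMapping H G φ

/-- The condition on `r` in the definition of `emb G`: every finite graph `H` without isolated
vertices and with sufficiently many edges, say `m`, is a minor of the blow-up `G^(⌈m / r⌉)`. -/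
def EmbAdmissible {V : Type*} (G : SimpleGraph V) (r : ℝ) : Prop :=
  ∃ m₀ : ℕ, ∀ (W : Type) [Finite W] (H : SimpleGraph W),
    (∀ v, ∃ w, H.Adj v w) → m₀ ≤ H.edgeSet.ncard →
      IsMinor H (blowup G ⌈(H.edgeSet.ncard : ℝ) / r⌉₊)

/-- `emb G` is the supremum of all admissible `r > 0`. It is taken in `[0, ∞]`, so that it is a
genuine supremum in every case. -/
noncomputable def emb {V : Type*} (G : SimpleGraph V) : ℝ≥0∞ :=
  ⨆ r ∈ {r : ℝ | 0 < r ∧ EmbAdmissible G r}, ENNReal.ofReal r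

/-- The `i`-th vertex of the path from `a` to `b` that changes the coordinates in order. -/
def bitFix {d q : ℕ} (i : ℕ) (a b : Fin d → Fin q) : Fin d → Fin q :=
  fun j => if (j : ℕ) < i then b j else a j

theorem bitFix_zero {d q : ℕ} (a b : Fin d → Fin q) : bitFix 0 a b = a := by
  funext j; simp [bitFix]

theorem bitFix_last {d q : ℕ} (a b : Fin d → Fin q) : bitFix d a b = b := by
  funext j; simp [bitFix]

theorem bitFix_add {d q : ℕ} [NeZero q] (i : ℕ) (a b z : Fin d → Fin q) :
    bitFix i (a + z) (b + z) = bitFix i a b + z := by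
  funext j; simp only [bitFix, Pi.add_apply]; split_ifs <;> rfl

theorem bitFix_succ {d q : ℕ} (i : ℕ) (a b : Fin d → Fin q) :
    bitFix i a b = bitFix (i + 1) a b ∨
      (hammingGraph q d).Adj (bitFix i a b) (bitFix (i + 1) a b) := by
  rw [or_iff_not_imp_left]
  intro hne
  change hammingDist _ _ = 1
  refine le_antisymm ?_ (Nat.one_le_iff_ne_zero.2 (hammingDist_ne_zero.2 hne))
  refine Finset.card_le_one.2 fun j hj l hl => ?_
  have key : ∀ j : Fin d, bitFix i a b j ≠ bitFix (i + 1) a b j → (j : ℕ) = i := by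
    intro j hj
    by_contra h
    apply hj
    have : (j : ℕ) < i ↔ (j : ℕ) < i + 1 := by omega
    simp [bitFix, this]
  simp only [Finset.mem_filter, Finset.mem_univ, true_and] at hj hl
  exact Fin.ext ((key j hj).trans (key l hl).symm)

/-- Second moment bound: if `X i` is equivariant under shifts along `T i` and invariant under shifts
along sets disjoint from `T i`, the number of `i` with `X i f = x` has a small variance. -/
theorem sum_sq_count_sub_le {W V I : Type*} [Fintype W] [DecidableEq W] [Fintype V] [DecidableEq V]
    [AddCommGroup V] (s : Finset I) (X : I → (W → V) → V) (T : I → Finset W)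
    (hX : ∀ i ∈ s, ∀ f z, X i (f + fun w => if w ∈ T i then z else 0) = X i f + z)
    (hX' : ∀ i ∈ s, ∀ j ∈ s, Disjoint (T i) (T j) → ∀ f z,
      X j (f + fun w => if w ∈ T i then z else 0) = X j f) (D : ℕ)
    (hD : ∀ i ∈ s, (s.filter fun j => ¬ Disjoint (T i) (T j)).card ≤ D) (x : V) :
    ∑ f : W → V, (((s.filter fun i => X i f = x).card : ℝ) - s.card / Fintype.card V) ^ 2 ≤
      (s.card * D : ℝ) * Fintype.card (W → V) := by
  classical
  set M : ℝ := (Fintype.card V : ℝ) with hM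
  have hM1 : 1 ≤ M := by
    have : 0 < Fintype.card V := Fintype.card_pos
    rw [hM]; exact_mod_cast this
  have hM0 : M ≠ 0 := by positivity
  set a : I → (W → V) → ℝ := fun i f => (if X i f = x then 1 else 0) - 1 / M with ha
  have habs : ∀ i f, |a i f| ≤ 1 := by
    intro i f
    have h1 : 1 / M ≤ 1 := by rw [div_le_one (by positivity)]; exact hM1
    have h2 : 0 ≤ 1 / M := by positivity
    simp only [ha]
    split_ifs <;> rw [abs_le] <;> constructor <;> linarith
  have hexp : ∀ f : W → V, (((s.filter fun i => X i f = x).card : ℝ) - s.card / M) ^ 2 =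
      ∑ i ∈ s, ∑ j ∈ s, a i f * a j f := by
    intro f
    rw [← Finset.sum_mul_sum, ← sq]
    congr 1
    simp only [ha, Finset.sum_sub_distrib, Finset.sum_const, nsmul_eq_mul, Finset.card_filter]
    push_cast
    ring
  have hcov : ∀ i ∈ s, ∀ j ∈ s, Disjoint (T i) (T j) → ∑ f, a i f * a j f = 0 := by
    intro i hi j hj hij
    have h1 : ∀ z : V, ∑ f, a i f * a j f =
        ∑ f, ((if X i f + z = x then 1 else 0) - 1 / M) * a j f := by
      intro z
      rw [← Equiv.sum_comp (Equiv.addRight (fun w => if w ∈ T i then z else 0 : W → V))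
        fun f => a i f * a j f]
      refine Finset.sum_congr rfl fun f _ => ?_
      simp only [Equiv.coe_addRight, ha, hX i hi, hX' i hi j hj hij]
    have h2 : M * ∑ f, a i f * a j f = 0 := by
      calc M * ∑ f, a i f * a j f = ∑ _z : V, ∑ f, a i f * a j f := by simp [hM]
        _ = ∑ z : V, ∑ f, ((if X i f + z = x then 1 else 0) - 1 / M) * a j f :=
          Finset.sum_congr rfl fun z _ => h1 z
        _ = ∑ f, (∑ z : V, ((if X i f + z = x then 1 else 0) - 1 / M)) * a j f := by
          rw [Finset.sum_comm]
          simp only [Finset.sum_mul]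
        _ = 0 := by
          refine Finset.sum_eq_zero fun f _ => ?_
          have : ∀ z, (X i f + z = x) ↔ z = x - X i f := fun z => by
            rw [eq_sub_iff_add_eq, add_comm]
          simp [this, ← hM, hM0]
    exact (mul_eq_zero.1 h2).resolve_left hM0
  simp only [hexp]
  rw [Finset.sum_comm]
  calc ∑ i ∈ s, ∑ f, ∑ j ∈ s, a i f * a j f
      = ∑ i ∈ s, ∑ j ∈ s, ∑ f, a i f * a j f := by
        refine Finset.sum_congr rfl fun i _ => Finset.sum_comm
    _ ≤ ∑ i ∈ s, ∑ j ∈ s, if ¬ Disjoint (T i) (T j) then (Fintype.card (W → V) : ℝ) else 0 := by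
        refine Finset.sum_le_sum fun i hi => Finset.sum_le_sum fun j hj => ?_
        split_ifs with h
        · exact (hcov i hi j hj h).le
        · calc ∑ f, a i f * a j f ≤ ∑ _f : W → V, (1 : ℝ) := by
                refine Finset.sum_le_sum fun f _ => ?_
                refine (le_abs_self _).trans ?_
                rw [abs_mul]
                exact mul_le_one₀ (habs i f) (abs_nonneg _) (habs j f)
            _ = _ := by simp
    _ ≤ ∑ i ∈ s, (D : ℝ) * Fintype.card (W → V) := by
        refine Finset.sum_le_sum fun i hi => ?_
        rw [← Finset.sum_filter, Finset.sum_const, nsmul_eq_mul]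
        gcongr
        exact hD i hi
    _ = _ := by simp [mul_assoc]

/-- Tokens located at the vertices of `G`, at most `k` per vertex, fit into the blow-up. -/
theorem exists_injective_fst_eq {T V : Type*} [Fintype T] [DecidableEq V] (loc : T → V) (k : ℕ)
    (h : ∀ x, (Finset.univ.filter fun t => loc t = x).card ≤ k) :
    ∃ g : T → V × Fin k, Function.Injective g ∧ ∀ t, (g t).1 = loc t := by
  have e : ∀ x, ∃ e : {t // loc t = x} → Fin k, Function.Injective e := by
    intro x
    have : Nonempty ({t // loc t = x} ↪ Fin k) := by
      apply Function.Embedding.nonempty_of_card_le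
      rw [Fintype.card_fin, Fintype.card_subtype]
      exact h x
    exact this.elim fun e => ⟨e, e.injective⟩
  choose e he using e
  refine ⟨fun t => (loc t, e (loc t) ⟨t, rfl⟩), fun t t' htt => ?_, fun t => rfl⟩
  rw [Prod.mk.injEq] at htt
  obtain ⟨h1, h2⟩ := htt
  have key : ∀ (x y : V) (hx : loc t = x) (hy : loc t' = y), x = y →
      e x ⟨t, hx⟩ = e y ⟨t', hy⟩ → t = t' := by
    rintro x _ hx hy rfl h
    exact congrArg Subtype.val (he x h)
  exact key _ _ rfl rfl h1 h2

theorem isMinor_blowup_of_tokens {W V T : Type*} [Fintype T] [DecidableEq V] (H : SimpleGraph W)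
    (G : SimpleGraph V) (k : ℕ) (own : T → W) (loc : T → V)
    (hk : ∀ x, (Finset.univ.filter fun t => loc t = x).card ≤ k)
    (hconn : ∀ u, ∃ t₀, own t₀ = u ∧ ∀ t, own t = u → Relation.ReflTransGen
      (fun t t' => own t' = u ∧ (loc t = loc t' ∨ G.Adj (loc t) (loc t'))) t₀ t)
    (hadj : ∀ u v, H.Adj u v → ∃ t t', own t = u ∧ own t' = v ∧
      (loc t = loc t' ∨ G.Adj (loc t) (loc t'))) :
    IsMinor H (blowup G k) := by
  obtain ⟨g, hg, hgl⟩ := exists_injective_fst_eq loc k hk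
  refine ⟨fun u => g '' {t | own t = u}, ⟨fun u => ?_, fun u v huv => ?_, fun u v huv => ?_⟩⟩
  · obtain ⟨t₀, h₀, ht⟩ := hconn u
    rw [SimpleGraph.connected_iff_exists_forall_reachable]
    refine ⟨⟨g t₀, t₀, h₀, rfl⟩, ?_⟩
    have key : ∀ t, Relation.ReflTransGen
        (fun t t' => own t' = u ∧ (loc t = loc t' ∨ G.Adj (loc t) (loc t'))) t₀ t →
        ∃ h : own t = u, ((blowup G k).induce (g '' {t | own t = u})).Reachable
          ⟨g t₀, t₀, h₀, rfl⟩ ⟨g t, t, h, rfl⟩ := by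
      intro t htt
      induction htt with
      | refl => exact ⟨h₀, SimpleGraph.Reachable.refl _⟩
      | @tail b c _ hbc ih =>
        obtain ⟨hb, hr⟩ := ih
        refine ⟨hbc.1, ?_⟩
        by_cases hne : b = c
        · subst hne; exact hr
        · refine hr.trans (SimpleGraph.Adj.reachable ?_)
          refine ⟨fun h => hne (hg h), ?_⟩
          change (g b).1 = (g c).1 ∨ G.Adj (g b).1 (g c).1
          rw [hgl, hgl]
          exact hbc.2
    rintro ⟨_, t, h, rfl⟩
    exact (key t (ht t h)).2
  · rw [Set.disjoint_left]
    rintro _ ⟨t, ht, rfl⟩ ⟨t', ht', h⟩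
    rw [hg h] at ht'
    exact huv (ht.symm.trans ht')
  · obtain ⟨t, t', h, h', hl⟩ := hadj u v huv
    refine ⟨g t, ⟨t, h, rfl⟩, g t', ⟨t', h', rfl⟩, fun hgg => ?_, by rw [hgl, hgl]; exact hl⟩
    rw [hg hgg, h'] at h
    exact huv.ne h.symm

theorem sum_subtype_ite_le {α : Type*} [Fintype α] (p r : α → Prop) [DecidablePred p]
    [DecidablePred r] : (∑ a : {a // p a}, if r a then 1 else 0) ≤
      (Finset.univ.filter fun a => p a ∧ r a).card := by
  rw [← Finset.card_filter, ← Finset.card_map (Function.Embedding.subtype _)]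
  refine Finset.card_le_card fun a => ?_
  simp +contextual

/-- If the vertices outside a set `A` are placed on the Hamming graph so that few of them, and few
of the paths for the edges among them, meet any given vertex, then `H` is a minor. -/
theorem isMinor_blowup_hammingGraph {W : Type*} [Fintype W] [DecidableEq W] (H : SimpleGraph W)
    [DecidableRel H.Adj] {q d k : ℕ} [NeZero q] (A : Finset W) (f : W → Fin d → Fin q)
    (h : ∀ x, A.card + (Finset.univ.filter fun w => f w = x).card +
      ∑ i ∈ Finset.range (d + 1), ((Finset.univ.filter fun p : W × W =>
        p.1 ∉ A ∧ p.2 ∉ A ∧ H.Adj p.1 p.2).filter fun p => bitFix i (f p.1) (f p.2) = x).card ≤ k) :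
    IsMinor H (blowup (hammingGraph q d) k) := by
  classical
  let T := ({w // w ∈ A} × (Fin d → Fin q)) ⊕ {w // w ∉ A} ⊕
    ({p : W × W // p.1 ∉ A ∧ p.2 ∉ A ∧ H.Adj p.1 p.2} × Fin (d + 1))
  let own : T → W := Sum.elim (fun t => t.1) (Sum.elim (fun w => w) fun t => t.1.1.1)
  let loc : T → Fin d → Fin q :=
    Sum.elim (fun t => t.2) (Sum.elim (fun w => f w) fun t => bitFix t.2 (f t.1.1.1) (f t.1.1.2))
  refine isMinor_blowup_of_tokens H (hammingGraph q d) k own loc (fun x => ?_) (fun u => ?_)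
    (fun u v huv => ?_)
  · refine le_trans ?_ (h x)
    rw [Finset.card_filter]
    simp only [T, Fintype.sum_sum_type, Fintype.sum_prod_type, loc, Sum.elim_inl, Sum.elim_inr]
    rw [add_assoc]
    refine Nat.add_le_add ?_ (Nat.add_le_add ?_ ?_)
    · refine (Finset.sum_le_card_nsmul _ _ 1 fun w _ => ?_).trans (by simp)
      exact (Finset.sum_ite_eq' Finset.univ x fun _ => 1).le.trans (by simp)
    · refine (sum_subtype_ite_le (fun w => w ∉ A) (fun w => f w = x)).trans ?_
      exact Finset.card_le_card fun w => by simp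
    · rw [Finset.sum_comm, Finset.sum_range]
      refine Finset.sum_le_sum fun i _ => ?_
      refine (sum_subtype_ite_le (fun p : W × W => p.1 ∉ A ∧ p.2 ∉ A ∧ H.Adj p.1 p.2)
        (fun p => bitFix i (f p.1) (f p.2) = x)).trans ?_
      exact Finset.card_le_card fun w => by simp
  · by_cases hu : u ∈ A
    · refine ⟨Sum.inl (⟨u, hu⟩, 0), rfl, ?_⟩
      have key : ∀ (b : Fin d → Fin q) (i : ℕ), Relation.ReflTransGen (fun t t' => own t' = u ∧
          (loc t = loc t' ∨ (hammingGraph q d).Adj (loc t) (loc t')))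
          (Sum.inl (⟨u, hu⟩, 0)) (Sum.inl (⟨u, hu⟩, bitFix i 0 b)) := by
        intro b i
        induction i with
        | zero => rw [bitFix_zero]
        | succ i ih => exact ih.tail ⟨rfl, bitFix_succ i 0 b⟩
      rintro (⟨⟨w, hw⟩, b⟩ | ⟨w, hw⟩ | ⟨⟨p, hp⟩, i⟩) hown
      · obtain rfl : w = u := hown
        have := key b d
        rwa [bitFix_last] at this
      · obtain rfl : w = u := hown
        exact absurd hu hw
      · obtain rfl : p.1 = u := hown
        exact absurd hu hp.1
    · refine ⟨Sum.inr (Sum.inl ⟨u, hu⟩), rfl, ?_⟩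
      rintro (⟨⟨w, hw⟩, b⟩ | ⟨w, hw⟩ | ⟨⟨p, hp⟩, i, hi⟩) hown
      · obtain rfl : w = u := hown
        exact absurd hw hu
      · obtain rfl : w = u := hown
        exact Relation.ReflTransGen.refl
      · obtain rfl : p.1 = u := hown
        induction i with
        | zero => exact Relation.ReflTransGen.single ⟨rfl, Or.inl (bitFix_zero (f p.1) (f p.2)).symm⟩
        | succ i ih => exact (ih (by omega)).tail ⟨rfl, bitFix_succ i _ _⟩
  · by_cases hu : u ∈ A
    · by_cases hv : v ∈ A
      · exact ⟨Sum.inl (⟨u, hu⟩, 0), Sum.inl (⟨v, hv⟩, 0), rfl, rfl, Or.inl rfl⟩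
      · exact ⟨Sum.inl (⟨u, hu⟩, f v), Sum.inr (Sum.inl ⟨v, hv⟩), rfl, rfl, Or.inl rfl⟩
    · by_cases hv : v ∈ A
      · exact ⟨Sum.inr (Sum.inl ⟨u, hu⟩), Sum.inl (⟨v, hv⟩, f u), rfl, rfl, Or.inl rfl⟩
      · exact ⟨Sum.inr (Sum.inr (⟨(u, v), hu, hv, huv⟩, Fin.last d)), Sum.inr (Sum.inl ⟨v, hv⟩),
          rfl, rfl, Or.inl (bitFix_last _ _)⟩

/-- A random placement of the vertices spreads them, and the bit-fixing paths of the pairs in `D`,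
evenly over the Hamming graph, provided every pair of `D` meets few others. -/
theorem exists_spread {W : Type*} [Fintype W] [DecidableEq W] {q d : ℕ} [NeZero q]
    (D : Finset (W × W)) (Δ : ℕ)
    (hΔ : ∀ p ∈ D, (D.filter fun p' =>
      ¬ Disjoint ({p.1, p.2} : Finset W) {p'.1, p'.2}).card ≤ Δ) (B : ℝ) (hB0 : 0 ≤ B)
    (hB : (q : ℝ) ^ d * (Fintype.card W + (d + 1) * (D.card * Δ)) ≤ B ^ 2) :
    ∃ f : W → Fin d → Fin q, ∀ x,
      ((Finset.univ.filter fun w => f w = x).card : ℝ) ≤ Fintype.card W / (q : ℝ) ^ d + B ∧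
      ∀ i ∈ Finset.range (d + 1),
        ((D.filter fun p => bitFix i (f p.1) (f p.2) = x).card : ℝ) ≤ D.card / (q : ℝ) ^ d + B := by
  classical
  have hM : (Fintype.card (Fin d → Fin q) : ℝ) = (q : ℝ) ^ d := by simp
  have h1 : ∀ x : Fin d → Fin q, ∑ f : W → Fin d → Fin q,
      (((Finset.univ.filter fun w => f w = x).card : ℝ) - Fintype.card W / (q : ℝ) ^ d) ^ 2 ≤
      (Fintype.card W : ℝ) * Fintype.card (W → Fin d → Fin q) := by
    intro x
    have := sum_sq_count_sub_le (V := Fin d → Fin q) (Finset.univ : Finset W) (fun w f => f w)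
      (fun w => {w}) (by intro w _ f z; simp) (by
        intro w _ w' _ h f z
        have : w' ≠ w := by rintro rfl; simp at h
        simp [this]) 1 (by
        intro w _
        refine Finset.card_le_one.2 fun a ha b hb => ?_
        simp only [Finset.mem_filter, Finset.disjoint_singleton, ne_eq, not_not] at ha hb
        exact ha.2.symm.trans hb.2) x
    rwa [hM, Finset.card_univ, Nat.cast_one, mul_one] at this
  have h2 : ∀ i, ∀ x : Fin d → Fin q, ∑ f : W → Fin d → Fin q,
      (((D.filter fun p => bitFix i (f p.1) (f p.2) = x).card : ℝ) - D.card / (q : ℝ) ^ d) ^ 2 ≤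
      (D.card * Δ : ℝ) * Fintype.card (W → Fin d → Fin q) := by
    intro i x
    have := sum_sq_count_sub_le (V := Fin d → Fin q) D (fun p f => bitFix i (f p.1) (f p.2))
      (fun p => {p.1, p.2}) (by intro p _ f z; simp [bitFix_add]) (by
        intro p _ p' _ h f z
        have ha : p'.1 ∉ ({p.1, p.2} : Finset W) := Finset.disjoint_right.1 h (by simp)
        have hb : p'.2 ∉ ({p.1, p.2} : Finset W) := Finset.disjoint_right.1 h (by simp)
        simp only [Pi.add_apply, if_neg ha, if_neg hb, add_zero]) Δ hΔ x
    rwa [hM] at this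
  obtain ⟨f, -, hf⟩ : ∃ f ∈ (Finset.univ : Finset (W → Fin d → Fin q)), ∑ x : Fin d → Fin q,
      ((((Finset.univ.filter fun w => f w = x).card : ℝ) - Fintype.card W / (q : ℝ) ^ d) ^ 2 +
      ∑ i ∈ Finset.range (d + 1), (((D.filter fun p => bitFix i (f p.1) (f p.2) = x).card : ℝ) -
        D.card / (q : ℝ) ^ d) ^ 2) ≤ B ^ 2 := by
    refine Finset.exists_le_of_sum_le Finset.univ_nonempty ?_
    rw [Finset.sum_comm]
    calc _ ≤ ∑ x : Fin d → Fin q, ((Fintype.card W : ℝ) * Fintype.card (W → Fin d → Fin q) +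
          ∑ i ∈ Finset.range (d + 1), (D.card * Δ : ℝ) * Fintype.card (W → Fin d → Fin q)) := by
          refine Finset.sum_le_sum fun x _ => ?_
          rw [Finset.sum_add_distrib, Finset.sum_comm]
          exact add_le_add (h1 x) (Finset.sum_le_sum fun i _ => h2 i x)
      _ = ((q : ℝ) ^ d * (Fintype.card W + (d + 1) * (D.card * Δ))) *
          Fintype.card (W → Fin d → Fin q) := by
          rw [Finset.sum_const, Finset.card_univ, nsmul_eq_mul, hM, Finset.sum_const,
            Finset.card_range, nsmul_eq_mul]
          push_cast
          ring
      _ ≤ B ^ 2 * Fintype.card (W → Fin d → Fin q) := by gcongr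
      _ = _ := by rw [Finset.sum_const, Finset.card_univ, nsmul_eq_mul, mul_comm]
  refine ⟨f, fun x => ?_⟩
  have hx := (Finset.single_le_sum (fun x _ => by positivity) (Finset.mem_univ x)).trans hf
  have hS : 0 ≤ ∑ i ∈ Finset.range (d + 1),
      (((D.filter fun p => bitFix i (f p.1) (f p.2) = x).card : ℝ) - D.card / (q : ℝ) ^ d) ^ 2 :=
    Finset.sum_nonneg fun i _ => sq_nonneg _
  constructor
  · linarith [le_of_sq_le_sq (le_trans (le_add_of_nonneg_right hS) hx) hB0]
  · intro i hi
    have h3 := (Finset.single_le_sum (f := fun i => (((D.filter fun p =>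
      bitFix i (f p.1) (f p.2) = x).card : ℝ) - D.card / (q : ℝ) ^ d) ^ 2)
      (fun i _ => sq_nonneg _) hi).trans ((le_add_of_nonneg_left (sq_nonneg _)).trans hx)
    linarith [le_of_sq_le_sq h3 hB0]

theorem card_filter_not_disjoint_le {W : Type*} [Fintype W] [DecidableEq W] (H : SimpleGraph W)
    [DecidableRel H.Adj] (D : Finset (W × W)) (hD : ∀ p ∈ D, H.Adj p.1 p.2) (u v : W) :
    (D.filter fun p => ¬ Disjoint ({u, v} : Finset W) {p.1, p.2}).card ≤
      2 * (H.degree u + H.degree v) := by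
  have hsub : (D.filter fun p => ¬ Disjoint ({u, v} : Finset W) {p.1, p.2}) ⊆
      ((H.neighborFinset u).image (fun w => (u, w)) ∪ (H.neighborFinset v).image (fun w => (v, w)))
      ∪ ((H.neighborFinset u).image (fun w => (w, u)) ∪
        (H.neighborFinset v).image (fun w => (w, v))) := by
    rintro ⟨a, b⟩ hp
    obtain ⟨hp, hd⟩ := Finset.mem_filter.1 hp
    have hab : H.Adj a b := hD _ hp
    have hba := hab.symm
    simp only [Finset.not_disjoint_iff, Finset.mem_insert, Finset.mem_singleton] at hd
    simp only [Finset.mem_union, Finset.mem_image, SimpleGraph.mem_neighborFinset, Prod.mk.injEq]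
    obtain ⟨w, rfl | rfl, rfl | rfl⟩ := hd
    · exact Or.inl (Or.inl ⟨b, hab, rfl, rfl⟩)
    · exact Or.inr (Or.inl ⟨a, hba, rfl, rfl⟩)
    · exact Or.inl (Or.inr ⟨b, hab, rfl, rfl⟩)
    · exact Or.inr (Or.inr ⟨a, hba, rfl, rfl⟩)
  refine (Finset.card_le_card hsub).trans ?_
  refine (Finset.card_union_le _ _).trans ?_
  have h1 := Finset.card_union_le ((H.neighborFinset u).image (fun w => (u, w)))
    ((H.neighborFinset v).image (fun w => (v, w)))
  have h2 := Finset.card_union_le ((H.neighborFinset u).image (fun w => (w, u)))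
    ((H.neighborFinset v).image (fun w => (w, v)))
  have h3 := Finset.card_image_le (s := H.neighborFinset u) (f := fun w => (u, w))
  have h4 := Finset.card_image_le (s := H.neighborFinset v) (f := fun w => (v, w))
  have h5 := Finset.card_image_le (s := H.neighborFinset u) (f := fun w => (w, u))
  have h6 := Finset.card_image_le (s := H.neighborFinset v) (f := fun w => (w, v))
  simp only [SimpleGraph.card_neighborFinset_eq_degree] at h3 h4 h5 h6
  omega

theorem embAdmissible_hammingGraph {q d : ℕ} (hq : 2 ≤ q) (hd : 1 ≤ d) :
    EmbAdmissible (hammingGraph q d) (1 / 10 * ((q : ℝ) ^ d / d)) := by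
  classical
  have : NeZero q := ⟨by omega⟩
  set M : ℕ := q ^ d with hM
  have hM1 : 1 ≤ M := Nat.one_le_pow _ _ (by omega)
  set K : ℕ := 16 * (d + 1) * M ^ 3 with hK
  have hK1 : 1 ≤ K := Nat.succ_le_of_lt (by positivity)
  refine ⟨4 * M ^ 3 + 2 * K * M + 1, fun W _ H hH hm => ?_⟩
  have := Fintype.ofFinite W
  set m := H.edgeSet.ncard with hmdef
  have hdeg : ∑ v, H.degree v = 2 * m := by
    rw [SimpleGraph.sum_degrees_eq_twice_card_edges, hmdef, Set.ncard_eq_toFinset_card']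
    rfl
  have hW : Fintype.card W ≤ 2 * m := by
    rw [← hdeg, ← Finset.card_univ, Finset.card_eq_sum_ones]
    refine Finset.sum_le_sum fun v _ => ?_
    exact (H.degree_pos_iff_exists_adj v).2 (hH v)
  set δ : ℕ := m / K with hδ
  set A : Finset W := Finset.univ.filter fun w => δ < H.degree w with hA
  have hAcard : A.card ≤ 2 * K := by
    have h1 : A.card * m ≤ 2 * K * m := by
      calc A.card * m ≤ ∑ w ∈ A, H.degree w * K := by
            rw [← smul_eq_mul]
            refine Finset.card_nsmul_le_sum _ _ _ fun w hw => ?_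
            have : m / K < H.degree w := (Finset.mem_filter.1 hw).2
            exact ((Nat.div_lt_iff_lt_mul hK1).1 this).le
        _ ≤ ∑ w, H.degree w * K := Finset.sum_le_sum_of_subset (Finset.subset_univ _)
        _ = 2 * K * m := by rw [← Finset.sum_mul, hdeg]; ring
    exact Nat.le_of_mul_le_mul_right h1 (by omega)
  set D : Finset (W × W) := Finset.univ.filter fun p : W × W =>
    p.1 ∉ A ∧ p.2 ∉ A ∧ H.Adj p.1 p.2 with hD
  have hDcard : D.card ≤ 2 * m := by
    calc D.card ≤ (Finset.univ.filter fun p : W × W => H.Adj p.1 p.2).card :=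
          Finset.card_le_card fun p hp => by
            simp only [hD, Finset.mem_filter] at hp ⊢
            exact ⟨hp.1, hp.2.2.2⟩
      _ = ∑ v, H.degree v := by
          rw [Finset.card_filter, Fintype.sum_prod_type]
          refine Finset.sum_congr rfl fun v _ => ?_
          rw [← Finset.card_filter, ← SimpleGraph.card_neighborFinset_eq_degree,
            SimpleGraph.neighborFinset_eq_filter]
      _ = 2 * m := hdeg
  have hΔ : ∀ p ∈ D, (D.filter fun p' =>
      ¬ Disjoint ({p.1, p.2} : Finset W) {p'.1, p'.2}).card ≤ 4 * δ := by
    intro p hp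
    refine (card_filter_not_disjoint_le H D (fun p hp => (Finset.mem_filter.1 hp).2.2.2) _ _).trans
      ?_
    obtain ⟨-, h1, h2, -⟩ := Finset.mem_filter.1 hp
    simp only [hA, Finset.mem_filter, Finset.mem_univ, true_and, not_lt] at h1 h2
    omega
  have hMr : (q : ℝ) ^ d = M := by rw [hM]; push_cast; rfl
  have hM1r : (1 : ℝ) ≤ M := by exact_mod_cast hM1
  have hKr : (K : ℝ) = 16 * (d + 1) * (M : ℝ) ^ 3 := by rw [hK]; push_cast; ring
  have hmr : 4 * (M : ℝ) ^ 3 + 2 * K * M + 1 ≤ m := by exact_mod_cast hm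
  have hWr : (Fintype.card W : ℝ) ≤ 2 * m := by exact_mod_cast hW
  have hDr : (D.card : ℝ) ≤ 2 * m := by exact_mod_cast hDcard
  have hδr : (δ : ℝ) * K ≤ m := by exact_mod_cast Nat.div_mul_le_self m K
  obtain ⟨f, hf⟩ := exists_spread D (4 * δ) hΔ (m / M) (by positivity) (by
    rw [hMr, div_pow, le_div_iff₀ (by positivity)]
    push_cast
    calc (M : ℝ) * (Fintype.card W + (d + 1) * (D.card * (4 * δ))) * M ^ 2
        ≤ (M : ℝ) * (2 * m + (d + 1) * (2 * m * (4 * δ))) * (M : ℝ) ^ 2 := by gcongr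
      _ = (4 * (M : ℝ) ^ 3) * m / 2 + m * (δ * K) / 2 := by rw [hKr]; ring
      _ ≤ (m : ℝ) * m / 2 + (m : ℝ) * m / 2 := by
          have : 4 * (M : ℝ) ^ 3 ≤ m := by
            have : (0 : ℝ) ≤ 2 * K * M := by positivity
            linarith
          gcongr
      _ = (m : ℝ) ^ 2 := by ring)
  refine isMinor_blowup_hammingGraph H A f fun x => ?_
  obtain ⟨h1, h2⟩ := hf x
  rw [hMr] at h1 h2
  have h3 := Finset.sum_le_card_nsmul _ _ _ h2
  rw [Finset.card_range, nsmul_eq_mul] at h3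
  have hAr : (A.card : ℝ) ≤ 2 * K := by exact_mod_cast hAcard
  have hd1 : (1 : ℝ) ≤ d := by exact_mod_cast hd
  refine Nat.cast_le (α := ℝ).1 (le_trans ?_ (Nat.le_ceil _))
  rw [hMr]
  push_cast at h3 ⊢
  have h4 : (Fintype.card W : ℝ) / M + m / M ≤ 3 * (m / M) := by
    have : (Fintype.card W : ℝ) / M ≤ 2 * m / M := by gcongr
    linarith [mul_div_assoc 2 (m : ℝ) M]
  have h5 : (D.card : ℝ) / M + m / M ≤ 3 * (m / M) := by
    have : (D.card : ℝ) / M ≤ 2 * m / M := by gcongr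
    linarith [mul_div_assoc 2 (m : ℝ) M]
  have h6 : ((d : ℝ) + 1) * (D.card / M + m / M) ≤ (d + 1) * (3 * (m / M)) := by gcongr
  have h7 : (2 : ℝ) * K ≤ m / M := by
    rw [le_div_iff₀ (by positivity)]
    have : (0 : ℝ) ≤ 4 * (M : ℝ) ^ 3 := by positivity
    linarith
  have h8 : (m : ℝ) / M ≤ d * (m / M) := le_mul_of_one_le_left (by positivity) hd1
  have h9 : (m : ℝ) / (1 / 10 * (M / d)) = 10 * (d * (m / M)) := by
    field_simp
  rw [h9]
  linarith

theorem hammingDist_fst_le_length {q d k : ℕ} {S : Set ((Fin d → Fin q) × Fin k)} {x y : S}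
    (p : ((blowup (hammingGraph q d) k).induce S).Walk x y) :
    hammingDist x.1.1 y.1.1 ≤ p.length := by
  induction p with
  | nil => simp
  | @cons u v w h p ih =>
    have h1 : hammingDist u.1.1 v.1.1 ≤ 1 := by
      rcases h.2 with h | h
      · change u.1.1 = v.1.1 at h
        simp [h]
      · exact (show hammingDist u.1.1 v.1.1 = 1 from h).le
    have := hammingDist_triangle u.1.1 v.1.1 w.1.1
    rw [SimpleGraph.Walk.length_cons]
    omega

/-- A minor of the blow-up can be placed on the Hamming graph with small fibres and short edges. -/
theorem IsMinorMapping.exists_placement {W : Type*} [Fintype W] {H : SimpleGraph W} {q d k : ℕ}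
    {φ : W → Set ((Fin d → Fin q) × Fin k)}
    (hφ : IsMinorMapping H (blowup (hammingGraph q d) k) φ) :
    ∃ (f : W → Fin d → Fin q) (s : W → ℕ),
      (∀ x, (Finset.univ.filter fun w => f w = x).card ≤ k) ∧ ∑ w, s w ≤ k * q ^ d ∧
      ∀ u v, H.Adj u v → hammingDist (f u) (f v) ≤ s u + s v := by
  classical
  have hne : ∀ u, (φ u).Nonempty := fun u =>
    Set.nonempty_coe_sort.1 (hφ.connected u).nonempty
  choose g hg using hne
  have hginj : Function.Injective g := by
    intro u v huv
    by_contra h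
    exact Set.disjoint_left.1 (hφ.disjoint u v h) (hg u) (huv ▸ hg v)
  have hdist : ∀ u, ∀ x ∈ φ u, ∀ y ∈ φ u, hammingDist x.1 y.1 + 1 ≤ (φ u).toFinset.card := by
    intro u x hx y hy
    obtain ⟨p⟩ := (hφ.connected u).preconnected ⟨x, hx⟩ ⟨y, hy⟩
    have h1 := hammingDist_fst_le_length p.toPath.1
    have h2 := p.toPath.2.length_lt
    rw [Set.toFinset_card]
    simp only at h1
    omega
  refine ⟨fun w => (g w).1, fun w => (φ w).toFinset.card, fun x => ?_, ?_, fun u v huv => ?_⟩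
  · calc _ = ((Finset.univ.filter fun w => (g w).1 = x).image fun w => (g w).2).card := by
          refine (Finset.card_image_of_injOn fun a ha b hb hab => hginj ?_).symm
          simp only [Finset.mem_coe, Finset.mem_filter, Finset.mem_univ, true_and] at ha hb
          exact Prod.ext (ha.trans hb.symm) hab
      _ ≤ k := (Finset.card_le_univ _).trans (by simp)
  · rw [← Finset.card_biUnion]
    · exact (Finset.card_le_univ _).trans (by simp [mul_comm])
    · intro u _ v _ huv
      simpa using hφ.disjoint u v huv
  · obtain ⟨x, hx, y, hy, hxy⟩ := hφ.adj u v huv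
    have h1 := hdist u _ (hg u) x hx
    have h2 := hdist v y hy _ (hg v)
    have h3 : hammingDist x.1 y.1 ≤ 1 := by
      rcases hxy.2 with h | h
      · simp [h]
      · exact (show hammingDist x.1 y.1 = 1 from h).le
    have h4 := hammingDist_triangle (g u).1 x.1 (g v).1
    have h5 := hammingDist_triangle x.1 y.1 (g v).1
    change hammingDist (g u).1 (g v).1 ≤ (φ u).toFinset.card + (φ v).toFinset.card
    omega

theorem sum_pow_hammingDist {q d : ℕ} (t : ℝ) (x : Fin d → Fin q) :
    ∑ y : Fin d → Fin q, t ^ hammingDist x y = (1 + (q - 1) * t) ^ d := by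
  have h : ∀ y : Fin d → Fin q, t ^ hammingDist x y = ∏ i, if x i = y i then 1 else t := by
    intro y
    rw [hammingDist, ← Finset.prod_const, Finset.prod_filter]
    exact Finset.prod_congr rfl fun i _ => by by_cases h : x i = y i <;> simp [h]
  have h1 : ∀ a : Fin q, ∑ b : Fin q, (if a = b then 1 else t) = 1 + (q - 1) * t := by
    intro a
    have : ∀ b, (if a = b then 1 else t) = (if a = b then 1 - t else 0) + t := by
      intro b; split_ifs <;> ring
    simp only [this, Finset.sum_add_distrib, Finset.sum_ite_eq, Finset.mem_univ, if_true,
      Finset.sum_const, Finset.card_univ, Fintype.card_fin, nsmul_eq_mul]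
    ring
  simp only [h]
  rw [← Fintype.piFinset_univ, ← Finset.prod_univ_sum (fun _ => Finset.univ)
    (fun i b => if x i = b then 1 else t)]
  simp [h1]

/-- Few permutations move the points of a well-spread placement only a short way on average. -/
theorem card_perm_sum_hammingDist_le {n q d k L : ℕ} (hq : 2 ≤ q) (f : Fin n → Fin d → Fin q)
    (hf : ∀ x, (Finset.univ.filter fun w => f w = x).card ≤ k) :
    ((Finset.univ.filter fun σ : Equiv.Perm (Fin n) =>
      ∑ u, hammingDist (f u) (f (σ u)) ≤ L).card : ℝ) ≤
      (q : ℝ) ^ L * (k * ((2 * q - 1) / q) ^ d) ^ n := by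
  classical
  have hq0 : (0 : ℝ) < q := by exact_mod_cast (by omega : 0 < q)
  set t : ℝ := (q : ℝ)⁻¹ with ht
  have ht0 : 0 < t := by positivity
  have ht1 : t ≤ 1 := inv_le_one_of_one_le₀ (by exact_mod_cast (by omega : 1 ≤ q))
  have hrow : ∀ u, ∑ v, t ^ hammingDist (f u) (f v) ≤ k * ((2 * q - 1) / q) ^ d := by
    intro u
    calc ∑ v, t ^ hammingDist (f u) (f v)
        = ∑ x, ∑ v ∈ Finset.univ.filter fun v => f v = x, t ^ hammingDist (f u) (f v) :=
          (Finset.sum_fiberwise _ _ _).symm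
      _ ≤ ∑ x : Fin d → Fin q, k * t ^ hammingDist (f u) x := by
          refine Finset.sum_le_sum fun x _ => ?_
          rw [Finset.sum_congr rfl (g := fun _ => t ^ hammingDist (f u) x) fun v hv => by
            rw [(Finset.mem_filter.1 hv).2], Finset.sum_const, nsmul_eq_mul]
          have := hf x
          gcongr
      _ = _ := by
          rw [← Finset.mul_sum, sum_pow_hammingDist]
          congr 2
          rw [ht]
          field_simp
          ring
  have hperm : ∑ σ : Equiv.Perm (Fin n), ∏ u, t ^ hammingDist (f u) (f (σ u)) ≤
      (k * ((2 * q - 1) / q) ^ d) ^ n := by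
    calc ∑ σ : Equiv.Perm (Fin n), ∏ u, t ^ hammingDist (f u) (f (σ u))
        = ∑ g ∈ (Finset.univ : Finset (Equiv.Perm (Fin n))).image
            (fun σ : Equiv.Perm (Fin n) => (⇑σ : Fin n → Fin n)), ∏ u, t ^ hammingDist (f u) (f (g u)) := by
          rw [Finset.sum_image]
          exact fun σ _ τ _ h => Equiv.ext (congrFun h)
      _ ≤ ∑ g : Fin n → Fin n, ∏ u, t ^ hammingDist (f u) (f (g u)) :=
          Finset.sum_le_sum_of_subset_of_nonneg (Finset.subset_univ _)
            fun g _ _ => Finset.prod_nonneg fun u _ => by positivity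
      _ = ∏ u, ∑ v, t ^ hammingDist (f u) (f v) := by
          rw [Finset.prod_univ_sum, Fintype.piFinset_univ]
      _ ≤ ∏ _u : Fin n, (k * ((2 * q - 1) / q) ^ d : ℝ) :=
          Finset.prod_le_prod (fun u _ => Finset.sum_nonneg fun v _ => by positivity)
            fun u _ => hrow u
      _ = _ := by simp
  set S := Finset.univ.filter fun σ : Equiv.Perm (Fin n) =>
    ∑ u, hammingDist (f u) (f (σ u)) ≤ L with hS
  have hcount : (S.card : ℝ) * t ^ L ≤
      ∑ σ : Equiv.Perm (Fin n), ∏ u, t ^ hammingDist (f u) (f (σ u)) := by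
    calc (S.card : ℝ) * t ^ L = ∑ _σ ∈ S, t ^ L := by rw [Finset.sum_const, nsmul_eq_mul]
      _ ≤ ∑ σ ∈ S, ∏ u, t ^ hammingDist (f u) (f (σ u)) := by
          refine Finset.sum_le_sum fun σ hσ => ?_
          rw [Finset.prod_pow_eq_pow_sum]
          exact pow_le_pow_of_le_one ht0.le ht1 (Finset.mem_filter.1 hσ).2
      _ ≤ _ := Finset.sum_le_sum_of_subset_of_nonneg (Finset.subset_univ _)
          fun σ _ _ => Finset.prod_nonneg fun u _ => pow_nonneg ht0.le _
  have h := hcount.trans hperm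
  rw [ht, inv_pow, ← div_eq_mul_inv, div_le_iff₀ (by positivity)] at h
  linarith

theorem mul_pow_lt_factorial_pow {n q d k : ℕ} (hq : 2 ≤ q) (hd : 1 ≤ d) (hn : 1 ≤ n)
    (hk : 100 * (k * q ^ d) ≤ d * n) :
    ((q : ℝ) ^ d) ^ n * ((q : ℝ) ^ (2 * (k * q ^ d)) * (k * ((2 * q - 1) / q) ^ d) ^ n) ^ 7 <
      (n.factorial : ℝ) ^ 7 := by
  have hq2 : (2 : ℝ) ≤ q := by exact_mod_cast hq
  have hq0 : (0 : ℝ) < q := by linarith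
  have hd1 : (1 : ℝ) ≤ d := by exact_mod_cast hd
  have hn1 : (1 : ℝ) ≤ n := by exact_mod_cast hn
  have hkr : 100 * (k * (q : ℝ) ^ d) ≤ d * n := by exact_mod_cast hk
  set l := Real.log q with hl
  have hql : (q : ℝ) = Real.exp l := (Real.exp_log hq0).symm
  have hl2 : 0.69 < l := by
    have := Real.log_two_gt_d9
    have := Real.log_le_log two_pos hq2
    linarith
  have hbase : (2 * (q : ℝ) - 1) / q ^ 2 ≤ Real.exp (-(l / 3)) := by
    refine le_of_pow_le_pow_left₀ (n := 3) (by norm_num) (Real.exp_pos _).le ?_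
    have h1 : Real.exp (-(l / 3)) ^ 3 = (q : ℝ)⁻¹ := by
      rw [← Real.exp_nat_mul, hql, ← Real.exp_neg]
      congr 1
      push_cast
      ring
    have h2 : (2 * (q : ℝ) - 1) ^ 3 ≤ q ^ 5 := by
      rcases hq.eq_or_lt with h | h
      · rw [← h]; norm_num
      · have hq3 : (3 : ℝ) ≤ q := by exact_mod_cast h
        calc (2 * (q : ℝ) - 1) ^ 3 ≤ (2 * (q : ℝ)) ^ 3 := by gcongr <;> linarith
          _ = 8 * (q : ℝ) ^ 3 := by ring
          _ ≤ (q : ℝ) ^ 2 * (q : ℝ) ^ 3 := by gcongr; nlinarith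
          _ = (q : ℝ) ^ 5 := by ring
    rw [h1, div_pow, div_le_iff₀ (by positivity)]
    calc (2 * (q : ℝ) - 1) ^ 3 ≤ (q : ℝ) ^ 5 := h2
      _ = (q : ℝ)⁻¹ * (q ^ 2) ^ 3 := by field_simp
  have hrow : (k : ℝ) * ((2 * q - 1) / q) ^ d ≤ d * n / 100 * Real.exp (-(l / 3)) ^ d := by
    calc (k : ℝ) * ((2 * q - 1) / q) ^ d = k * (q : ℝ) ^ d * ((2 * q - 1) / q ^ 2) ^ d := by
          rw [mul_assoc, ← mul_pow]
          congr 2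
          field_simp
      _ ≤ d * n / 100 * Real.exp (-(l / 3)) ^ d := by
          have : 0 ≤ (2 * (q : ℝ) - 1) / q ^ 2 := div_nonneg (by linarith) (by positivity)
          gcongr
          linarith
  have hpow : (q : ℝ) ^ (2 * (k * q ^ d)) ≤ Real.exp (d * l / 50) ^ n := by
    rw [hql, ← Real.exp_nat_mul, ← Real.exp_nat_mul, Real.exp_le_exp]
    have : (2 * (k * q ^ d) : ℝ) * l ≤ (d * n / 50) * l := by gcongr; linarith
    push_cast
    linarith
  have hd3 : 3 * (d : ℝ) / 100 ≤ Real.exp (d * l / 8) := by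
    have h1 := Real.add_one_le_exp (d * l / 8)
    have h2 : (d : ℝ) * 0.69 ≤ d * l := by gcongr
    linarith
  have hnn : (n : ℝ) ^ n ≤ 3 ^ n * n.factorial := by
    have h1 := Real.pow_div_factorial_le_exp (n : ℝ) (by positivity) n
    rw [div_le_iff₀ (by positivity)] at h1
    refine h1.trans ?_
    gcongr
    rw [← mul_one (n : ℝ), Real.exp_nat_mul]
    gcongr
    linarith [Real.exp_one_lt_d9]
  have hb0 : (0 : ℝ) ≤ k * ((2 * q - 1) / q) ^ d :=
    mul_nonneg (by positivity) (pow_nonneg (div_nonneg (by linarith) hq0.le) _)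
  have hX : (q : ℝ) ^ (2 * (k * q ^ d)) * (k * ((2 * q - 1) / q) ^ d) ^ n ≤
      Real.exp (-(d * l * 0.18)) ^ n * n.factorial := by
    calc (q : ℝ) ^ (2 * (k * q ^ d)) * (k * ((2 * q - 1) / q) ^ d) ^ n
        ≤ Real.exp (d * l / 50) ^ n * (d * n / 100 * Real.exp (-(l / 3)) ^ d) ^ n := by gcongr
      _ = (Real.exp (d * l / 50) * (d / 100) * Real.exp (-(l / 3)) ^ d) ^ n * (n : ℝ) ^ n := by
          simp only [← mul_pow]; congr 1; ring
      _ ≤ (Real.exp (d * l / 50) * (d / 100) * Real.exp (-(l / 3)) ^ d) ^ n *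
          (3 ^ n * n.factorial) := by gcongr
      _ = (Real.exp (d * l / 50) * (3 * d / 100) * Real.exp (-(l / 3)) ^ d) ^ n *
          n.factorial := by
          rw [← mul_assoc, ← mul_pow]; congr 2; ring
      _ ≤ (Real.exp (d * l / 50) * Real.exp (d * l / 8) * Real.exp (-(l / 3)) ^ d) ^ n *
          n.factorial := by gcongr
      _ ≤ Real.exp (-(d * l * 0.18)) ^ n * n.factorial := by
          gcongr
          rw [← Real.exp_nat_mul, ← Real.exp_add, ← Real.exp_add, Real.exp_le_exp]
          have : 0 ≤ (d : ℝ) * l := by positivity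
          linarith
  calc ((q : ℝ) ^ d) ^ n * ((q : ℝ) ^ (2 * (k * q ^ d)) * (k * ((2 * q - 1) / q) ^ d) ^ n) ^ 7
      ≤ (Real.exp l ^ d) ^ n * (Real.exp (-(d * l * 0.18)) ^ n * n.factorial) ^ 7 := by
        rw [← hql]; gcongr
    _ = Real.exp (-(n * (d * l) * 0.26)) * (n.factorial : ℝ) ^ 7 := by
        rw [mul_pow, ← mul_assoc]
        simp only [← Real.exp_nat_mul, ← Real.exp_add]
        congr 2
        push_cast
        ring
    _ < 1 * (n.factorial : ℝ) ^ 7 := by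
        gcongr
        rw [Real.exp_lt_one_iff]
        have : 0 < (n : ℝ) * (d * l) := by positivity
        linarith
    _ = _ := one_mul _

/-- Some seven permutations cannot all move the points of a well-spread placement only a short
way, whatever the placement. -/
theorem exists_perm_hammingDist_lt {n q d k : ℕ} (hq : 2 ≤ q) (hd : 1 ≤ d) (hn : 1 ≤ n)
    (hk : 100 * (k * q ^ d) ≤ d * n) :
    ∃ π : Fin 7 → Equiv.Perm (Fin n), ∀ f : Fin n → Fin d → Fin q,
      (∀ x, (Finset.univ.filter fun w => f w = x).card ≤ k) →
      ∃ j, 2 * (k * q ^ d) < ∑ u, hammingDist (f u) (f (π j u)) := by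
  classical
  by_contra! hcon
  set F : Finset (Fin n → Fin d → Fin q) := Finset.univ.filter fun f =>
    ∀ x, (Finset.univ.filter fun w => f w = x).card ≤ k with hF
  let S : (Fin n → Fin d → Fin q) → Finset (Equiv.Perm (Fin n)) := fun f =>
    Finset.univ.filter fun σ => ∑ u, hammingDist (f u) (f (σ u)) ≤ 2 * (k * q ^ d)
  have hsub : (Finset.univ : Finset (Fin 7 → Equiv.Perm (Fin n))) ⊆
      F.biUnion fun f => Fintype.piFinset fun _ => S f := by
    intro π _
    obtain ⟨f, hf, hfj⟩ := hcon π
    refine Finset.mem_biUnion.2 ⟨f, Finset.mem_filter.2 ⟨Finset.mem_univ _, hf⟩, ?_⟩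
    exact Fintype.mem_piFinset.2 fun j => Finset.mem_filter.2 ⟨Finset.mem_univ _, hfj j⟩
  have h1 := (Finset.card_le_card hsub).trans Finset.card_biUnion_le
  have h2 : ((n.factorial : ℝ)) ^ 7 ≤ ∑ f ∈ F, ((S f).card : ℝ) ^ 7 := by
    have h3 : (Finset.univ : Finset (Fin 7 → Equiv.Perm (Fin n))).card = n.factorial ^ 7 := by
      rw [Finset.card_univ, Fintype.card_fun, Fintype.card_perm, Fintype.card_fin,
        Fintype.card_fin]
    rw [h3] at h1
    simp only [Fintype.card_piFinset_const] at h1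
    exact_mod_cast h1
  refine absurd (mul_pow_lt_factorial_pow hq hd hn hk) (not_lt.2 (h2.trans ?_))
  have hnn : (0 : ℝ) ≤ (q : ℝ) ^ (2 * (k * q ^ d)) * (k * ((2 * q - 1) / q) ^ d) ^ n := by
    have hq2 : (2 : ℝ) ≤ q := by exact_mod_cast hq
    have : 0 ≤ (2 * (q : ℝ) - 1) / q := div_nonneg (by linarith) (by linarith)
    positivity
  calc ∑ f ∈ F, ((S f).card : ℝ) ^ 7
      ≤ F.card • ((q : ℝ) ^ (2 * (k * q ^ d)) * (k * ((2 * q - 1) / q) ^ d) ^ n) ^ 7 := by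
        refine Finset.sum_le_card_nsmul _ _ _ fun f hf => ?_
        exact pow_le_pow_left₀ (by positivity)
          (card_perm_sum_hammingDist_le hq f (Finset.mem_filter.1 hf).2) 7
    _ ≤ _ := by
        rw [nsmul_eq_mul]
        refine mul_le_mul_of_nonneg_right ?_ (pow_nonneg hnn 7)
        have : F.card ≤ (q ^ d) ^ n := (Finset.card_le_univ _).trans (by simp)
        exact_mod_cast this

/-- The union of the functional graphs of a family of permutations and a spanning star. -/
def starPermGraph {n c : ℕ} (π : Fin c → Equiv.Perm (Fin (n + 1))) : SimpleGraph (Fin (n + 1)) :=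
  SimpleGraph.fromRel fun u v => u = 0 ∨ ∃ j, π j u = v

theorem le_ncard_edgeSet_starPermGraph {n c : ℕ} (π : Fin c → Equiv.Perm (Fin (n + 1))) :
    n ≤ (starPermGraph π).edgeSet.ncard := by
  have hinj : Function.Injective fun v : Fin n => s((0 : Fin (n + 1)), v.succ) := by
    intro v w h
    simpa using h
  calc n = (Set.range fun v : Fin n => s((0 : Fin (n + 1)), v.succ)).ncard := by
        rw [← Set.image_univ, Set.ncard_image_of_injective _ hinj, Set.ncard_univ, Nat.card_fin]
    _ ≤ _ := by
        refine Set.ncard_le_ncard ?_ (Set.toFinite _)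
        rintro _ ⟨v, rfl⟩
        exact ⟨(Fin.succ_ne_zero v).symm, Or.inl (Or.inl rfl)⟩

theorem ncard_edgeSet_starPermGraph_le {n c : ℕ} (π : Fin c → Equiv.Perm (Fin (n + 1))) :
    (starPermGraph π).edgeSet.ncard ≤ (c + 1) * (n + 1) := by
  let g : Option (Fin c) × Fin (n + 1) → Sym2 (Fin (n + 1)) := fun p =>
    s(p.1.elim 0 fun _ => p.2, p.1.elim p.2 fun j => π j p.2)
  have hsub : (starPermGraph π).edgeSet ⊆ Set.range g := by
    intro e
    induction e with
    | _ u v =>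
      intro huv
      obtain ⟨-, h⟩ : u ≠ v ∧ ((u = 0 ∨ ∃ j, π j u = v) ∨ (v = 0 ∨ ∃ j, π j v = u)) := huv
      obtain (rfl | ⟨j, rfl⟩) | (rfl | ⟨j, rfl⟩) := h
      · exact ⟨(none, v), rfl⟩
      · exact ⟨(some j, u), rfl⟩
      · exact ⟨(none, u), Sym2.eq_swap⟩
      · exact ⟨(some j, v), Sym2.eq_swap⟩
  calc _ ≤ (Set.range g).ncard := Set.ncard_le_ncard hsub (Set.toFinite _)
    _ ≤ Nat.card (Option (Fin c) × Fin (n + 1)) := by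
        rw [← Set.image_univ, ← Set.ncard_univ]
        exact Set.ncard_image_le (Set.toFinite _)
    _ = _ := by simp

theorem EmbAdmissible.le_of_hammingGraph {q d : ℕ} (hq : 2 ≤ q) (hd : 1 ≤ d) {r : ℝ} (hr0 : 0 < r)
    (hr : EmbAdmissible (hammingGraph q d) r) : r ≤ 1600 * ((q : ℝ) ^ d / d) := by
  by_contra! hlt
  obtain ⟨m₀, h⟩ := hr
  have hM0 : (0 : ℝ) < (q : ℝ) ^ d := by
    have : (0 : ℝ) < q := by exact_mod_cast (by omega : 0 < q)
    positivity
  have hd1 : (1 : ℝ) ≤ d := by exact_mod_cast hd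
  set n : ℕ := m₀ + 200 * q ^ d + 1 with hn
  have hnr : 200 * (q : ℝ) ^ d ≤ n := by
    have : 200 * q ^ d ≤ n := by omega
    exact_mod_cast this
  set k : ℕ := ⌈8 * ((n : ℝ) + 1) / r⌉₊ with hk
  have hkn : 100 * (k * q ^ d) ≤ d * (n + 1) := by
    have h1 : 8 * ((n : ℝ) + 1) / r ≤ (n + 1) * d / (200 * (q : ℝ) ^ d) := by
      calc 8 * ((n : ℝ) + 1) / r ≤ 8 * (n + 1) / (1600 * ((q : ℝ) ^ d / d)) := by gcongr
        _ = _ := by field_simp; norm_num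
    have h2 : (k : ℝ) ≤ (n + 1) * d / (200 * (q : ℝ) ^ d) + 1 := by
      have := Nat.ceil_lt_add_one (a := 8 * ((n : ℝ) + 1) / r) (by positivity)
      linarith
    have h3 : 100 * ((k : ℝ) * (q : ℝ) ^ d) ≤ d * (n + 1) := by
      calc 100 * ((k : ℝ) * (q : ℝ) ^ d)
          ≤ 100 * (((n + 1) * d / (200 * (q : ℝ) ^ d) + 1) * (q : ℝ) ^ d) := by gcongr
        _ = d * (n + 1) / 2 + 200 * (q : ℝ) ^ d / 2 := by field_simp; ring
        _ ≤ d * (n + 1) / 2 + d * (n + 1) / 2 := by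
            have : (n : ℝ) + 1 ≤ d * (n + 1) := le_mul_of_one_le_left (by positivity) hd1
            linarith
        _ = _ := by ring
    exact_mod_cast h3
  obtain ⟨π, hπ⟩ := exists_perm_hammingDist_lt hq hd (Nat.succ_le_succ (Nat.zero_le n)) hkn
  have hlow := le_ncard_edgeSet_starPermGraph π
  have hup := ncard_edgeSet_starPermGraph_le π
  obtain ⟨φ, hφ⟩ := h (Fin (n + 1)) (starPermGraph π) (fun v => by
    by_cases hv : v = 0
    · exact ⟨Fin.last n, by rw [hv, ne_eq, Fin.ext_iff]; simp, Or.inl (Or.inl hv)⟩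
    · exact ⟨0, hv, Or.inr (Or.inl rfl)⟩) (by omega)
  obtain ⟨f, s, hf, hs, hfs⟩ := hφ.exists_placement
  have hle : ⌈((starPermGraph π).edgeSet.ncard : ℝ) / r⌉₊ ≤ k := by
    refine Nat.ceil_mono ?_
    have : ((starPermGraph π).edgeSet.ncard : ℝ) ≤ 8 * (n + 1) := by exact_mod_cast hup
    gcongr
  obtain ⟨j, hj⟩ := hπ f fun x => (hf x).trans hle
  refine absurd hj (not_lt.2 ?_)
  calc ∑ u, hammingDist (f u) (f (π j u)) ≤ ∑ u, (s u + s (π j u)) := by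
        refine Finset.sum_le_sum fun u _ => ?_
        by_cases hu : u = π j u
        · rw [← hu, hammingDist_self]; exact Nat.zero_le _
        · exact hfs _ _ ⟨hu, Or.inl (Or.inr ⟨j, rfl⟩)⟩
    _ = 2 * ∑ u, s u := by
        rw [Finset.sum_add_distrib, Equiv.sum_comp (π j) s, two_mul]
    _ ≤ 2 * (k * q ^ d) := by
        have := hs.trans (Nat.mul_le_mul_right (q ^ d) hle)
        omega

theorem mainTheorem6 :
    ∃ c C : ℝ, 0 < c ∧ 0 < C ∧ ∀ q d : ℕ, 2 ≤ q → 1 ≤ d →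
      ENNReal.ofReal (c * ((q : ℝ) ^ d / (d : ℝ))) ≤ emb (hammingGraph q d) ∧
      emb (hammingGraph q d) ≤ ENNReal.ofReal (C * ((q : ℝ) ^ d / (d : ℝ))) := by
  refine ⟨1 / 10, 1600, by norm_num, by norm_num, fun q d hq hd => ⟨?_, ?_⟩⟩
  · have hpos : 0 < 1 / 10 * ((q : ℝ) ^ d / (d : ℝ)) := by
      have : (0 : ℝ) < q := by exact_mod_cast (by omega : 0 < q)
      have : (0 : ℝ) < d := by exact_mod_cast hd
      positivity
    exact le_iSup₂_of_le (f := fun (r : ℝ) (_ : r ∈ {r : ℝ | 0 < r ∧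
      EmbAdmissible (hammingGraph q d) r}) => ENNReal.ofReal r) _
      ⟨hpos, embAdmissible_hammingGraph hq hd⟩ le_rfl
  · exact iSup₂_le fun r hr =>
      ENNReal.ofReal_le_ofReal (EmbAdmissible.le_of_hammingGraph hq hd hr.1 hr.2)
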